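/- For $k\in\mathbb N=\{1,2,3,\ldots\}$ let $Q_k$ be the $k$-dimensional hypercube: the simple graph whose vertices are the $2^k$ binary strings of length $k$, two strings being adjacent if and only if they differ in exactly one position. For every $k\in\mathbb N$, \[ \min_{(H_1,H_2)}\ \max\bigl(|V(H_1)|,|V(H_2)|\bigr)\;=\;\sum_{\ell=0}^{\lfloor k/2\rfloor}\binom{k}{\ell}+(k\bmod 2)\binom{k-1}{\lfloor k/2\rfloor}, \] where the minimum is taken over all pairs $(H_1,H_2)$ of induced subgraphs of $Q_k$ with $E(H_1)\cup E(H_2)=E(Q_k)$. -/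

import Mathlib

/-- The `k`-dimensional hypercube `Q_k`: the vertices are the binary strings of length `k`, and two
strings are adjacent iff their Hamming distance is `1`. -/
def hypercube (k : ℕ) : SimpleGraph (Fin k → Bool) where
  Adj x y := hammingDist x y = 1
  symm := ⟨fun x y h => by rw [hammingDist_comm]; exact h⟩
  loopless := ⟨fun x h => by simp at h⟩

/-- The pair `H₁`, `H₂` consists of induced subgraphs of `Q_k` that together cover its edges,
`E(H₁) ∪ E(H₂) = E(Q_k)`. -/
def IsInducedEdgeCover (k : ℕ) (H₁ H₂ : (hypercube k).Subgraph) : Prop :=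
  H₁.IsInduced ∧ H₂.IsInduced ∧ H₁.edgeSet ∪ H₂.edgeSet = (hypercube k).edgeSet

/-!
Put `k = m + 1`, and let `S t` be the volume of the Hamming ball of radius `t` in `Q_m`,
interpolated linearly in `t`. In an induced edge cover, the closed neighbourhood of the complement
of `H₂` lies in `H₁`, so the lower bound follows from an isoperimetric inequality: a nonempty set of
at least `2 * S t` vertices of `Q_{m+1}` has at least `2 * S (t + 1)` vertices in its closed
neighbourhood. The critical radius is `t = m / 2`, since `S (m / 2) + S (m / 2 + 1) = 2 ^ m`.

The isoperimetric inequality is proved by induction on `m`, splitting the cube into two facets. By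
Pascal's rule the volumes in `Q_{m+1}` are `S t + S (t - 1)`, so the induction step compares pairs
of values of `S` with the same sum before and after a shift of the radius by one, and comes down to
the concavity of `S t ↦ S (t + 1)`. This map is piecewise linear with slopes `(m - r) / (r + 1)`,
which decrease in `r`.
-/

section RampFunction

/-- The ramp function: `0` on negative numbers, the identity on `[0, 1]`, and `1` beyond. -/
def ramp (x : ℝ) : ℝ := max 0 (min x 1)

lemma ramp_mono : Monotone ramp := fun _ _ h => max_le_max_left _ (min_le_min_right _ h)

lemma continuous_ramp : Continuous ramp := by unfold ramp; fun_prop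

lemma ramp_of_nonpos {x : ℝ} (hx : x ≤ 0) : ramp x = 0 :=
  max_eq_left ((min_le_left _ _).trans hx)

lemma ramp_of_one_le {x : ℝ} (hx : 1 ≤ x) : ramp x = 1 := by simp [ramp, hx]

lemma ramp_add_ramp_one_sub (x : ℝ) : ramp x + ramp (1 - x) = 1 := by
  unfold ramp; grind

lemma ramp_natCast_sub_natCast (r l : ℕ) : ramp (r - l) = if l < r then 1 else 0 := by
  split_ifs with h
  · exact ramp_of_one_le (le_sub_iff_add_le'.2 (by exact_mod_cast h))
  · exact ramp_of_nonpos (sub_nonpos.2 (by exact_mod_cast not_lt.1 h))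

lemma two_mul_ramp_intCast_add_half (z : ℤ) : 2 * ramp (z + 1 / 2) = ramp (z + 1) + ramp z := by
  rcases lt_trichotomy z 0 with h | rfl | h
  · have hz : (z : ℝ) + 1 ≤ 0 := by exact_mod_cast h
    simp only [ramp_of_nonpos (x := z + 1 / 2) (by linarith), ramp_of_nonpos hz,
      ramp_of_nonpos (x := z) (by linarith), mul_zero, add_zero]
  · norm_num [ramp]
  · have hz : (1 : ℝ) ≤ z := by exact_mod_cast h
    rw [ramp_of_one_le (x := z + 1 / 2) (by linarith), ramp_of_one_le (x := z + 1) (by linarith),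
      ramp_of_one_le hz, two_mul]

end RampFunction

section BallVolume

/-- The volume of the open Hamming ball of radius `t` in `Q_n`, interpolated linearly between
consecutive integer values of `t`. -/
noncomputable def ballVolume (n : ℕ) (t : ℝ) : ℝ :=
  ∑ l ∈ Finset.range (n + 1), n.choose l * ramp (t - l)

variable {n : ℕ}

lemma ballVolume_mono (n : ℕ) : Monotone (ballVolume n) := fun _ _ h =>
  Finset.sum_le_sum fun _ _ =>
    mul_le_mul_of_nonneg_left (ramp_mono (sub_le_sub_right h _)) (Nat.cast_nonneg _)

lemma continuous_ballVolume (n : ℕ) : Continuous (ballVolume n) := by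
  have := continuous_ramp
  unfold ballVolume
  fun_prop

lemma ballVolume_of_nonpos {t : ℝ} (ht : t ≤ 0) : ballVolume n t = 0 :=
  Finset.sum_eq_zero fun l _ => by
    rw [ramp_of_nonpos (sub_nonpos.2 (ht.trans l.cast_nonneg)), mul_zero]

lemma ballVolume_nonneg (n : ℕ) (t : ℝ) : 0 ≤ ballVolume n t := by
  rw [← ballVolume_of_nonpos (n := n) (min_le_right t 0)]
  exact ballVolume_mono n (min_le_left t 0)

lemma ballVolume_add_ballVolume_reflect (n : ℕ) (t : ℝ) :
    ballVolume n t + ballVolume n (n + 1 - t) = 2 ^ n := by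
  have hsum : ∑ l ∈ Finset.range (n + 1), (n.choose l : ℝ) = 2 ^ n := by
    exact_mod_cast Nat.sum_range_choose n
  rw [ballVolume, ballVolume, ← Finset.sum_range_reflect (fun l => _ * ramp (n + 1 - t - l)),
    ← hsum, ← Finset.sum_add_distrib]
  refine Finset.sum_congr rfl fun l hl => ?_
  have hln : l ≤ n := Finset.mem_range_succ_iff.1 hl
  rw [add_tsub_cancel_right, Nat.choose_symm hln, ← mul_add, Nat.cast_sub hln,
    show (n : ℝ) + 1 - t - (n - l) = 1 - (t - l) by ring, ramp_add_ramp_one_sub, mul_one]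

lemma ballVolume_of_add_one_le {t : ℝ} (ht : n + 1 ≤ t) : ballVolume n t = 2 ^ n := by
  rw [← ballVolume_add_ballVolume_reflect n t, ballVolume_of_nonpos (sub_nonpos.2 ht), add_zero]

lemma ballVolume_le_two_pow (n : ℕ) (t : ℝ) : ballVolume n t ≤ 2 ^ n := by
  rw [← ballVolume_of_add_one_le (le_max_right t (n + 1))]
  exact ballVolume_mono n (le_max_left _ _)

lemma exists_ballVolume_eq {t x : ℝ} (ht : 0 ≤ t) (hx : 0 ≤ x) (hxt : x ≤ ballVolume n t) :
    ∃ u ∈ Set.Icc 0 t, ballVolume n u = x :=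
  intermediate_value_Icc ht (continuous_ballVolume n).continuousOn
    ⟨(ballVolume_of_nonpos le_rfl).trans_le hx, hxt⟩

lemma ballVolume_natCast (n r : ℕ) : ballVolume n r = ∑ l ∈ Finset.range r, (n.choose l : ℝ) := by
  simp only [ballVolume, ramp_natCast_sub_natCast, mul_ite, mul_one, mul_zero]
  rw [← Finset.sum_filter]
  refine Finset.sum_subset (fun l hl => by simp_all) fun l hl hl' => ?_
  have hnl : n < l := by simp_all
  rw [Nat.choose_eq_zero_of_lt hnl, Nat.cast_zero]

lemma ballVolume_succ (n : ℕ) (t : ℝ) :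
    ballVolume (n + 1) t = ballVolume n t + ballVolume n (t - 1) := by
  have h := Finset.sum_choose_succ_mul (R := ℝ) (fun i _ => ramp (t - i)) n
  simpa [ballVolume, sub_sub, add_comm (1 : ℝ)] using h

lemma two_mul_ballVolume_add_half (n r : ℕ) :
    2 * ballVolume n (r + 1 / 2) = ballVolume (n + 1) (r + 1) := by
  rw [ballVolume_succ, add_sub_cancel_right]
  simp only [ballVolume, Finset.mul_sum, ← Finset.sum_add_distrib]
  refine Finset.sum_congr rfl fun l _ => ?_
  have h := two_mul_ramp_intCast_add_half (r - l)
  push_cast at h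
  rw [mul_left_comm, ← mul_add, add_sub_right_comm, h, add_sub_right_comm]

lemma ballVolume_shift_identity (n : ℕ) (r t : ℝ) :
    (r + 1) * ballVolume n (t + 1) - (n - r) * ballVolume n t =
      ∑ j ∈ Finset.range (n + 2), (n + 1).choose j * ((r + 1 - j) * ramp (t + 1 - j)) := by
  have absorption : ∑ j ∈ Finset.range (n + 2), (n + 1).choose j * (j * ramp (t + 1 - j)) =
      (n + 1) * ballVolume n t := by
    rw [Finset.sum_range_succ', ballVolume, Finset.mul_sum]
    simp only [Nat.cast_zero, mul_zero, zero_mul, add_zero]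
    refine Finset.sum_congr rfl fun j _ => ?_
    have h : ((n : ℝ) + 1) * n.choose j = (n + 1).choose (j + 1) * (j + 1) := by
      exact_mod_cast Nat.add_one_mul_choose_eq n j
    rw [← mul_assoc, ← mul_assoc, h, Nat.cast_succ, add_sub_add_right_eq_sub]
  have pascal := ballVolume_succ n (t + 1)
  rw [add_sub_cancel_right] at pascal
  calc (r + 1) * ballVolume n (t + 1) - (n - r) * ballVolume n t
      = (r + 1) * ballVolume (n + 1) (t + 1) - (n + 1) * ballVolume n t := by
        rw [pascal]; ring
    _ = _ := by
        rw [← absorption, ballVolume, Finset.mul_sum, ← Finset.sum_sub_distrib]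
        exact Finset.sum_congr rfl fun j _ => by ring

-- Together with the next lemma: the slope of `t ↦ (ballVolume n t, ballVolume n (t + 1))` is at
-- least `(n - r) / (r + 1)` up to `t = r + 1`, and at most that from `t = r` on.
lemma mul_ballVolume_sub_le_of_le_add_one {r : ℕ} {a b : ℝ} (hab : a ≤ b) (hb : b ≤ r + 1) :
    (n - r) * (ballVolume n b - ballVolume n a) ≤
      (r + 1) * (ballVolume n (b + 1) - ballVolume n (a + 1)) := by
  suffices h : (r + 1) * ballVolume n (a + 1) - (n - r) * ballVolume n a ≤
      (r + 1) * ballVolume n (b + 1) - (n - r) * ballVolume n b by linarith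
  rw [ballVolume_shift_identity, ballVolume_shift_identity]
  refine Finset.sum_le_sum fun j _ => mul_le_mul_of_nonneg_left ?_ (Nat.cast_nonneg _)
  rcases le_or_gt j (r + 1) with hj | hj
  · have hj' : (j : ℝ) ≤ r + 1 := by exact_mod_cast hj
    exact mul_le_mul_of_nonneg_left (ramp_mono (by linarith)) (by linarith)
  · have hj' : (r : ℝ) + 1 + 1 ≤ j := by exact_mod_cast hj
    rw [ramp_of_nonpos (by linarith), ramp_of_nonpos (by linarith)]

lemma mul_ballVolume_sub_le_of_le {r : ℕ} {c d : ℝ} (hc : r ≤ c) (hcd : c ≤ d) :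
    (r + 1) * (ballVolume n (d + 1) - ballVolume n (c + 1)) ≤
      (n - r) * (ballVolume n d - ballVolume n c) := by
  suffices h : (r + 1) * ballVolume n (d + 1) - (n - r) * ballVolume n d ≤
      (r + 1) * ballVolume n (c + 1) - (n - r) * ballVolume n c by linarith
  rw [ballVolume_shift_identity, ballVolume_shift_identity]
  refine Finset.sum_le_sum fun j _ => mul_le_mul_of_nonneg_left ?_ (Nat.cast_nonneg _)
  rcases le_or_gt j r with hj | hj
  · have hj' : (j : ℝ) ≤ r := by exact_mod_cast hj
    rw [ramp_of_one_le (by linarith), ramp_of_one_le (by linarith)]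
  · have hj' : (r : ℝ) + 1 ≤ j := by exact_mod_cast hj
    exact mul_le_mul_of_nonpos_left (ramp_mono (by linarith)) (by linarith)

lemma ballVolume_add_one_add_le {a b c d : ℝ} (hab : a ≤ b) (hbc : b ≤ c) (hcd : c ≤ d)
    (hb : 0 ≤ b) (h : ballVolume n a + ballVolume n d ≤ ballVolume n b + ballVolume n c) :
    ballVolume n (a + 1) + ballVolume n (d + 1) ≤
      ballVolume n (b + 1) + ballVolume n (c + 1) := by
  rcases le_or_gt ((n : ℝ) + 1) b with hn | hn
  · rw [ballVolume_of_add_one_le (t := b + 1) (by linarith),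
      ballVolume_of_add_one_le (t := c + 1) (by linarith)]
    exact add_le_add (ballVolume_le_two_pow n _) (ballVolume_le_two_pow n _)
  · set r := ⌊b⌋₊
    have hrb : (r : ℝ) ≤ b := Nat.floor_le hb
    have hrn : (0 : ℝ) ≤ n - r := by
      have : r < n + 1 := (Nat.floor_lt hb).2 (by exact_mod_cast hn)
      exact sub_nonneg.2 (by exact_mod_cast Nat.le_of_lt_succ this)
    have hbr : b ≤ r + 1 := (Nat.lt_floor_add_one b).le
    have slope_ab := mul_ballVolume_sub_le_of_le_add_one (n := n) hab hbr
    have slope_cd := mul_ballVolume_sub_le_of_le (n := n) (hrb.trans hbc) hcd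
    have gap := mul_nonneg hrn (sub_nonneg.2 h)
    refine le_of_mul_le_mul_left ?_ (show (0 : ℝ) < r + 1 by positivity)
    linarith

lemma ballVolume_add_one_le {a b : ℝ} (hb : 0 ≤ b) (h : ballVolume n a ≤ ballVolume n b) :
    ballVolume n (a + 1) ≤ ballVolume n (b + 1) := by
  rcases le_total a b with hab | hba
  · exact ballVolume_mono n (by linarith)
  · exact le_of_add_le_add_left
      (ballVolume_add_one_add_le le_rfl le_rfl hba hb (add_le_add_right h _))

lemma ballVolume_succ_add_one_le_or {t y z : ℝ} (hz : 0 ≤ z) (hzy : z ≤ y)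
    (h : ballVolume (n + 1) t ≤ ballVolume n y + ballVolume n z) :
    ballVolume (n + 1) (t + 1) ≤ ballVolume n (y + 1) + ballVolume n y ∨
      0 < ballVolume n z ∧
        ballVolume (n + 1) (t + 1) ≤ ballVolume n (y + 1) + ballVolume n (z + 1) := by
  rw [ballVolume_succ] at h
  rw [ballVolume_succ, add_sub_cancel_right]
  rcases le_or_gt (ballVolume n t) (ballVolume n y) with hty | hyt
  · exact .inl (add_le_add (ballVolume_add_one_le (hz.trans hzy) hty) hty)
  · have htz : ballVolume n (t - 1) < ballVolume n z := by linarith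
    have concave := ballVolume_add_one_add_le ((ballVolume_mono n).reflect_lt htz).le hzy
      ((ballVolume_mono n).reflect_lt hyt).le hz (by linarith)
    rw [sub_add_cancel] at concave
    exact .inr ⟨(ballVolume_nonneg n _).trans_lt htz, by linarith⟩

end BallVolume

section Cube

variable {n : ℕ}

/-- The vertices of the cube at distance at most one from `X`. -/
def closedNbhd (X : Finset (Fin n → Bool)) : Finset (Fin n → Bool) :=
  {y | ∃ x ∈ X, hammingDist x y ≤ 1}

/-- The facet `x₀ = c` of `X`, as a subset of the cube of one dimension less. -/
def cubeSlice (c : Bool) (X : Finset (Fin (n + 1) → Bool)) : Finset (Fin n → Bool) :=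
  {y | Fin.cons c y ∈ X}

lemma mem_closedNbhd {X : Finset (Fin n → Bool)} {y : Fin n → Bool} :
    y ∈ closedNbhd X ↔ ∃ x ∈ X, hammingDist x y ≤ 1 := Finset.mem_filter_univ _

lemma mem_cubeSlice {c : Bool} {X : Finset (Fin (n + 1) → Bool)} {y : Fin n → Bool} :
    y ∈ cubeSlice c X ↔ Fin.cons c y ∈ X := Finset.mem_filter_univ _

lemma hammingDist_cons (a b : Bool) (x y : Fin n → Bool) :
    hammingDist (Fin.cons a x : Fin (n + 1) → Bool) (Fin.cons b y) =
      (if a ≠ b then 1 else 0) + hammingDist x y := by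
  simp only [hammingDist, Finset.card_filter, Fin.sum_univ_succ, Fin.cons_zero, Fin.cons_succ]

lemma hammingDist_bot_cons (b : Bool) (y : Fin n → Bool) :
    hammingDist (⊥ : Fin (n + 1) → Bool) (Fin.cons b y) =
      (if b then 1 else 0) + hammingDist ⊥ y := by
  rw [← Fin.cons_self_tail (⊥ : Fin (n + 1) → Bool), hammingDist_cons]
  cases b <;> rfl

lemma hammingDist_tail_le (x y : Fin (n + 1) → Bool) :
    hammingDist (Fin.tail x) (Fin.tail y) ≤ hammingDist x y := by
  conv_rhs => rw [← Fin.cons_self_tail x, ← Fin.cons_self_tail y, hammingDist_cons]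
  exact Nat.le_add_left _ _

lemma sum_cube_succ {M : Type*} [AddCommMonoid M] (f : (Fin (n + 1) → Bool) → M) :
    ∑ x, f x = ∑ y, f (Fin.cons true y) + ∑ y, f (Fin.cons false y) := by
  rw [← (Fin.consEquiv fun _ => Bool).sum_comp, Fintype.sum_prod_type, Fintype.sum_bool]
  rfl

lemma card_cubeSlice_add_card_cubeSlice_not (c : Bool) (X : Finset (Fin (n + 1) → Bool)) :
    (cubeSlice c X).card + (cubeSlice (!c) X).card = X.card := by
  have h : (cubeSlice true X).card + (cubeSlice false X).card = X.card := by
    simp only [cubeSlice, Finset.card_filter, ← sum_cube_succ fun x => if x ∈ X then 1 else 0]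
    simp
  cases c
  · rwa [add_comm]
  · exact h

lemma closedNbhd_cubeSlice_subset (c : Bool) (X : Finset (Fin (n + 1) → Bool)) :
    closedNbhd (cubeSlice c X) ⊆ cubeSlice c (closedNbhd X) := fun y hy => by
  obtain ⟨x, hx, hxy⟩ := mem_closedNbhd.1 hy
  exact mem_cubeSlice.2 (mem_closedNbhd.2 ⟨_, mem_cubeSlice.1 hx, by simpa [hammingDist_cons]⟩)

lemma cubeSlice_subset_cubeSlice_not_closedNbhd (c : Bool) (X : Finset (Fin (n + 1) → Bool)) :
    cubeSlice c X ⊆ cubeSlice (!c) (closedNbhd X) := fun y hy =>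
  mem_cubeSlice.2 (mem_closedNbhd.2 ⟨_, mem_cubeSlice.1 hy, by simp [hammingDist_cons]⟩)

lemma card_closedNbhd_cubeSlice_add_le (c : Bool) (X : Finset (Fin (n + 1) → Bool)) :
    (closedNbhd (cubeSlice c X)).card + (closedNbhd (cubeSlice (!c) X)).card ≤
      (closedNbhd X).card := by
  rw [← card_cubeSlice_add_card_cubeSlice_not c (closedNbhd X)]
  gcongr <;> exact closedNbhd_cubeSlice_subset _ _

lemma card_closedNbhd_cubeSlice_add_card_le (c : Bool) (X : Finset (Fin (n + 1) → Bool)) :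
    (closedNbhd (cubeSlice c X)).card + (cubeSlice c X).card ≤ (closedNbhd X).card := by
  rw [← card_cubeSlice_add_card_cubeSlice_not c (closedNbhd X)]
  gcongr
  · exact closedNbhd_cubeSlice_subset _ _
  · exact cubeSlice_subset_cubeSlice_not_closedNbhd _ _

lemma exists_cubeSlice_not_card_le (X : Finset (Fin (n + 1) → Bool)) :
    ∃ c, (cubeSlice (!c) X).card ≤ (cubeSlice c X).card :=
  (le_total (cubeSlice true X).card (cubeSlice false X).card).elim (⟨false, ·⟩) (⟨true, ·⟩)

lemma card_le_two_pow (X : Finset (Fin n → Bool)) : X.card ≤ 2 ^ n := by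
  simpa using X.card_le_univ

end Cube

section Isoperimetry

lemma card_closedNbhd_of_nonempty {X : Finset (Fin 1 → Bool)} (hX : X.Nonempty) :
    (closedNbhd X).card = 2 := by
  obtain ⟨x, hx⟩ := hX
  have huniv : closedNbhd X = Finset.univ := Finset.eq_univ_of_forall fun y =>
    mem_closedNbhd.2 ⟨x, hx, by simpa using hammingDist_le_card_fintype (x := x) (y := y)⟩
  simp [huniv]

lemma exists_two_mul_ballVolume_eq_card {m : ℕ} (X : Finset (Fin (m + 1) → Bool)) :
    ∃ t, 0 ≤ t ∧ 2 * ballVolume m t = X.card := by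
  have hX : (X.card : ℝ) ≤ 2 ^ (m + 1) := by exact_mod_cast card_le_two_pow X
  obtain ⟨t, ⟨ht, -⟩, h⟩ := exists_ballVolume_eq (n := m) (t := m + 1) (x := X.card / 2)
    (by positivity) (by positivity) (by
      rw [ballVolume_of_add_one_le le_rfl, div_le_iff₀ two_pos, ← pow_succ]
      exact hX)
  exact ⟨t, ht, by rw [h, mul_div_cancel₀ _ two_ne_zero]⟩

/-- Equality holds for the product of a Hamming ball with an edge when `t ∈ ℕ`, and for a Hamming
ball when `t ∈ ℕ + 1 / 2`. -/
theorem two_mul_ballVolume_le_card_closedNbhd {m : ℕ} {X : Finset (Fin (m + 1) → Bool)} {t : ℝ}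
    (hX : X.Nonempty) (h : 2 * ballVolume m t ≤ X.card) :
    2 * ballVolume m (t + 1) ≤ (closedNbhd X).card := by
  induction m generalizing t with
  | zero =>
    rw [card_closedNbhd_of_nonempty hX]
    simpa using ballVolume_le_two_pow 0 (t + 1)
  | succ m ih =>
    obtain ⟨c, hc⟩ := exists_cubeSlice_not_card_le X
    set Y := cubeSlice c X
    set Z := cubeSlice (!c) X
    have hYZ : Y.card + Z.card = X.card := card_cubeSlice_add_card_cubeSlice_not c X
    have hNYZ : ((closedNbhd Y).card + (closedNbhd Z).card : ℝ) ≤ (closedNbhd X).card := by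
      exact_mod_cast card_closedNbhd_cubeSlice_add_le c X
    have hNYY : ((closedNbhd Y).card + Y.card : ℝ) ≤ (closedNbhd X).card := by
      exact_mod_cast card_closedNbhd_cubeSlice_add_card_le c X
    have hY : Y.Nonempty := Finset.card_pos.1 (by have := hX.card_pos; omega)
    obtain ⟨y, hy, hyY⟩ := exists_two_mul_ballVolume_eq_card Y
    obtain ⟨z, ⟨hz, hzy⟩, hzZ⟩ := exists_ballVolume_eq (n := m) (x := Z.card / 2) hy
      (by positivity) (by linarith [(Nat.cast_le (α := ℝ)).2 hc])
    have hNY := ih hY hyY.le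
    have hsum : ballVolume (m + 1) t ≤ ballVolume m y + ballVolume m z := by
      rw [← hYZ, Nat.cast_add] at h
      linarith
    rcases ballVolume_succ_add_one_le_or hz hzy hsum with hN | ⟨hzpos, hN⟩
    · linarith
    · have hZ : Z.Nonempty := Finset.card_pos.1 (Nat.cast_pos.1 (by linarith : (0 : ℝ) < Z.card))
      have hNZ := ih (t := z) hZ (by linarith)
      linarith

end Isoperimetry

section EdgeCovers

lemma isInducedEdgeCover_induce {k : ℕ} {A B : Set (Fin k → Bool)}
    (h : ∀ x y, (hypercube k).Adj x y → x ∈ A ∧ y ∈ A ∨ x ∈ B ∧ y ∈ B) :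
    IsInducedEdgeCover k ((⊤ : (hypercube k).Subgraph).induce A)
      ((⊤ : (hypercube k).Subgraph).induce B) := by
  refine ⟨fun x hx y hy hxy => ⟨hx, hy, hxy⟩, fun x hx y hy hxy => ⟨hx, hy, hxy⟩, ?_⟩
  ext e
  induction e using Sym2.ind with
  | _ x y =>
    simp only [Set.mem_union, SimpleGraph.Subgraph.mem_edgeSet, SimpleGraph.mem_edgeSet,
      SimpleGraph.Subgraph.induce_adj, SimpleGraph.Subgraph.top_adj]
    have := h x y
    tauto

lemma exists_hypercube_adj {m : ℕ} (x : Fin (m + 1) → Bool) : ∃ y, (hypercube (m + 1)).Adj x y := by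
  refine ⟨Fin.cons (!x 0) (Fin.tail x), ?_⟩
  change hammingDist x _ = 1
  conv_lhs => rw [← Fin.cons_self_tail x, hammingDist_cons]
  simp

lemma closedNbhd_subset_of_isInducedEdgeCover {m : ℕ} {H₁ H₂ : (hypercube (m + 1)).Subgraph}
    (h : IsInducedEdgeCover (m + 1) H₁ H₂) {X : Finset (Fin (m + 1) → Bool)}
    (hX : ∀ x ∈ X, x ∉ H₂.verts) : (closedNbhd X : Set (Fin (m + 1) → Bool)) ⊆ H₁.verts := by
  have adj_of_mem : ∀ x ∈ X, ∀ y, (hypercube (m + 1)).Adj x y → H₁.Adj x y := fun x hx y hxy => by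
    have hmem : s(x, y) ∈ H₁.edgeSet ∪ H₂.edgeSet := h.2.2 ▸ hxy
    exact hmem.resolve_right fun h' => hX x hx (H₂.edge_vert h')
  intro y hy
  obtain ⟨x, hx, hxy⟩ := mem_closedNbhd.1 hy
  rcases Nat.le_one_iff_eq_zero_or_eq_one.1 hxy with h0 | h1
  · obtain rfl := hammingDist_eq_zero.1 h0
    obtain ⟨y, hxy⟩ := exists_hypercube_adj x
    exact H₁.edge_vert (adj_of_mem x hx y hxy)
  · exact H₁.edge_vert (adj_of_mem x hx y h1).symm

lemma ncard_add_ncard_compl_cube {k : ℕ} (A : Set (Fin k → Bool)) :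
    (A.ncard + Aᶜ.ncard : ℝ) = 2 ^ k := by
  have h := Set.ncard_add_ncard_compl A
  rw [Nat.card_eq_fintype_card, Fintype.card_fun, Fintype.card_bool, Fintype.card_fin] at h
  exact_mod_cast h

lemma two_mul_ballVolume_half_add (m : ℕ) :
    2 * ballVolume m (m / 2) + 2 * ballVolume m (m / 2 + 1) = 2 ^ (m + 1) := by
  have h := ballVolume_add_ballVolume_reflect m (m / 2)
  rw [show (m : ℝ) + 1 - m / 2 = m / 2 + 1 by ring] at h
  rw [← mul_add, h, pow_succ, mul_comm]

theorem two_mul_ballVolume_le_max_ncard {m : ℕ} {H₁ H₂ : (hypercube (m + 1)).Subgraph}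
    (h : IsInducedEdgeCover (m + 1) H₁ H₂) :
    2 * ballVolume m (m / 2 + 1) ≤ (max H₁.verts.ncard H₂.verts.ncard : ℕ) := by
  classical
  rw [Nat.cast_max, le_max_iff, or_iff_not_imp_right, not_le]
  intro hlt
  set X := H₂.vertsᶜ.toFinset
  have hXcard : 2 * ballVolume m (m / 2) < X.card := by
    rw [← Set.ncard_eq_toFinset_card']
    linarith [ncard_add_ncard_compl_cube H₂.verts, two_mul_ballVolume_half_add m]
  have hXpos : (0 : ℝ) < X.card := by linarith [ballVolume_nonneg m (m / 2)]
  calc 2 * ballVolume m (m / 2 + 1) ≤ (closedNbhd X).card :=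
        two_mul_ballVolume_le_card_closedNbhd (Finset.card_pos.1 (Nat.cast_pos.1 hXpos))
          hXcard.le
    _ ≤ H₁.verts.ncard := by
        rw [← Set.ncard_coe_finset]
        exact_mod_cast Set.ncard_le_ncard
          (closedNbhd_subset_of_isInducedEdgeCover h fun x hx => by simpa [X] using hx)

lemma ncard_setOf_lt {k : ℕ} (v : (Fin k → Bool) → ℕ) (r : ℕ) :
    ({x | v x < r}.ncard : ℝ) = ∑ x, ramp (r - v x) := by
  simp only [ramp_natCast_sub_natCast, Finset.sum_boole]
  rw [← Set.ncard_coe_finset, Finset.coe_filter_univ]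

lemma sum_ramp_sub_hammingDist_bot (n : ℕ) (t : ℝ) :
    ∑ x : Fin n → Bool, ramp (t - hammingDist ⊥ x) = ballVolume n t := by
  induction n generalizing t with
  | zero => simp [ballVolume, hammingDist]
  | succ n ih =>
    rw [sum_cube_succ, ballVolume_succ, ← ih, ← ih, add_comm]
    simp [hammingDist_bot_cons, sub_sub]

lemma exists_middle_layers (m : ℕ) : ∃ (v : (Fin (m + 1) → Bool) → ℕ) (t : ℕ),
    (∀ x y, v y ≤ v x + hammingDist x y) ∧
    ({x | v x < t}.ncard : ℝ) = 2 * ballVolume m (m / 2) ∧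
    ({x | v x < t + 1}.ncard : ℝ) = 2 * ballVolume m (m / 2 + 1) := by
  obtain ⟨s, rfl | rfl⟩ := m.even_or_odd'
  · have card (r : ℕ) : ({x : Fin (2 * s + 1) → Bool | hammingDist ⊥ (Fin.tail x) < r}.ncard : ℝ) =
        2 * ballVolume (2 * s) r := by
      rw [ncard_setOf_lt, sum_cube_succ, ← sum_ramp_sub_hammingDist_bot]
      simp only [Fin.tail_cons, two_mul]
    refine ⟨fun x => hammingDist ⊥ (Fin.tail x), s, fun x y => ?_, ?_, ?_⟩
    · grw [← hammingDist_tail_le x y]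
      exact hammingDist_triangle _ _ _
    · rw [card, Nat.cast_mul, Nat.cast_two, mul_div_cancel_left₀ _ two_ne_zero]
    · rw [card, Nat.cast_succ, Nat.cast_mul, Nat.cast_two, mul_div_cancel_left₀ _ two_ne_zero]
  · have card (r : ℕ) :
        ({x : Fin (2 * s + 1 + 1) → Bool | hammingDist ⊥ x < r + 1}.ncard : ℝ) =
        2 * ballVolume (2 * s + 1) (r + 1 / 2) := by
      rw [ncard_setOf_lt, sum_ramp_sub_hammingDist_bot, two_mul_ballVolume_add_half, Nat.cast_succ]
    refine ⟨hammingDist ⊥, s + 1, hammingDist_triangle _, ?_, ?_⟩ <;>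
      rw [card] <;> congr 2 <;> push_cast <;> ring

theorem exists_isInducedEdgeCover (m : ℕ) : ∃ H₁ H₂ : (hypercube (m + 1)).Subgraph,
    IsInducedEdgeCover (m + 1) H₁ H₂ ∧
    ((max H₁.verts.ncard H₂.verts.ncard : ℕ) : ℝ) = 2 * ballVolume m (m / 2 + 1) := by
  obtain ⟨v, t, hv, hlow, hhigh⟩ := exists_middle_layers m
  have hupper : ({x | v x < t}ᶜ.ncard : ℝ) = 2 * ballVolume m (m / 2 + 1) := by
    linarith [ncard_add_ncard_compl_cube {x | v x < t}, two_mul_ballVolume_half_add m]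
  refine ⟨_, _, isInducedEdgeCover_induce (A := {x | v x < t + 1}) (B := {x | v x < t}ᶜ) ?_, ?_⟩
  · intro x y (hxy : hammingDist x y = 1)
    have hxy' := hv x y
    have hyx' := hv y x
    rw [hammingDist_comm] at hyx'
    simp only [Set.mem_ofPred_eq, Set.mem_compl_iff]
    omega
  · rw [Nat.cast_max, SimpleGraph.Subgraph.induce_verts, SimpleGraph.Subgraph.induce_verts, hhigh,
      hupper, max_self]

lemma sum_choose_add_eq_two_mul_ballVolume (m : ℕ) :
    ((∑ l ∈ Finset.range ((m + 1) / 2 + 1), (m + 1).choose l +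
      (m + 1) % 2 * m.choose ((m + 1) / 2) : ℕ) : ℝ) = 2 * ballVolume m (m / 2 + 1) := by
  obtain ⟨s, rfl | rfl⟩ := m.even_or_odd'
  · rw [show (2 * s + 1) / 2 = s by omega, show (2 * s + 1) % 2 = 1 by omega]
    have pascal := ballVolume_succ (2 * s) (s + 1)
    have step : ballVolume (2 * s) (s + 1) = ballVolume (2 * s) s + (2 * s).choose s := by
      exact_mod_cast by simp only [ballVolume_natCast, Finset.sum_range_succ]
    have sum_eq := ballVolume_natCast (2 * s + 1) (s + 1)
    push_cast at sum_eq ⊢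
    rw [add_sub_cancel_right] at pascal
    rw [← sum_eq, mul_div_cancel_left₀ _ two_ne_zero]
    linarith
  · rw [show (2 * s + 1 + 1) / 2 = s + 1 by omega, show (2 * s + 1 + 1) % 2 = 0 by omega]
    have half := two_mul_ballVolume_add_half (2 * s + 1) (s + 1)
    have sum_eq := ballVolume_natCast (2 * s + 1 + 1) (s + 1 + 1)
    push_cast at half sum_eq ⊢
    rw [zero_mul, add_zero, ← sum_eq, ← half]
    congr 2
    ring

end EdgeCovers

theorem theorem4p1 (k : ℕ) (hk : 1 ≤ k) :
    IsLeast
      {n : ℕ | ∃ H₁ H₂ : (hypercube k).Subgraph, IsInducedEdgeCover k H₁ H₂ ∧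
        n = max H₁.verts.ncard H₂.verts.ncard}
      ((∑ ℓ ∈ Finset.range (k / 2 + 1), k.choose ℓ) + (k % 2) * (k - 1).choose (k / 2)) := by
  obtain ⟨m, rfl⟩ := Nat.exists_eq_add_of_le' hk
  have value := sum_choose_add_eq_two_mul_ballVolume m
  constructor
  · obtain ⟨H₁, H₂, hcover, hmax⟩ := exists_isInducedEdgeCover m
    exact ⟨H₁, H₂, hcover, Nat.cast_injective (value.trans hmax.symm)⟩
  · rintro _ ⟨H₁, H₂, hcover, rfl⟩
    exact Nat.cast_le.1 (value.trans_le (two_mul_ballVolume_le_max_ncard hcover))
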